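/- Consider one-sided online bipartite matching. An instance $I$ of size $n$ is a finite bipartite graph with $n$ online vertices and an arbitrary finite number of offline vertices; $v(I)$ denotes the size of a maximum matching. The online vertices arrive one after the other, each together with the set of its offline neighbours. The algorithm Random matches each arriving vertex to one of its neighbours that are not yet matched, chosen uniformly at random, and leaves it unmatched if there is no such neighbour; its choices are irrevocable. For $\sigma\in S_n$ let $v(\mathrm{Random}, I(\sigma))$ be the expected size of the matching that Random constructs when the online vertices of $I$ arrive in the order given by $\sigma$. Theorem. In the random order model, where $\sigma\in S_n$ is chosen uniformly at random, the asymptotic approximation ratio of Random is at most $3/4$, that is, $$\liminf_{n\to\infty}\ \inf_{I}\ \frac{\mathbb{E}_{\sigma\in S_n}\left[v(\mathrm{Random}, I(\sigma))\right]}{v(I)}\ \le\ \frac34,$$ where the infimum is over all instances $I$ of size $n$ with $v(I)>0$. -/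

import Mathlib

open scoped ENNReal

namespace OnlineMatching

/-- An instance of one-sided online bipartite matching with `n` online vertices (the data items)
and an arbitrary finite number `m` of offline vertices: every online vertex has a set of offline
neighbours. The size of the instance is its number `n` of data items. -/
structure Instance (n : ℕ) where
  /-- the number of offline vertices -/
  m : ℕ
  /-- the neighbourhood of an online vertex -/
  nbr : Fin n → Finset (Fin m)

/-- A set of edges is a matching if it consists of edges of the graph and no two of them share
an online or an offline vertex. -/
def Instance.IsMatching {n : ℕ} (I : Instance n) (S : Finset (Fin n × Fin I.m)) : Prop :=
  (∀ e ∈ S, e.2 ∈ I.nbr e.1) ∧ ∀ e ∈ S, ∀ f ∈ S, e ≠ f → e.1 ≠ f.1 ∧ e.2 ≠ f.2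

open Classical in
/-- The optimal value of an instance: the size of a maximum matching. -/
noncomputable def Instance.opt {n : ℕ} (I : Instance n) : ℕ :=
  ((Finset.univ : Finset (Finset (Fin n × Fin I.m))).filter I.IsMatching).sup Finset.card

/-- A data item: an online vertex together with the set of all its offline neighbours. -/
abbrev DataItem (n m : ℕ) : Type := Fin n × Finset (Fin m)

/-- The data items processed so far, in order of arrival, each with the decision taken for it:
`some v` if it was matched to the offline vertex `v`, `none` if it was left unmatched. -/
abbrev History (n m : ℕ) : Type := List (DataItem n m × Option (Fin m))

/-- The vertices of `N` to which no earlier online vertex has been matched. -/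
def available {n m : ℕ} (h : History n m) (N : Finset (Fin m)) : Finset (Fin m) :=
  N.filter fun v => ∀ e ∈ h, e.2 ≠ some v

/-- The number of online vertices that have been matched. -/
def matchedCount {n m : ℕ} (h : History n m) : ℕ :=
  h.countP fun e => e.2.isSome

/-- A (randomized) online algorithm: given all previously seen data items with the decisions taken
for them, and the data item that has just arrived, it chooses (at random) a decision, and an online
vertex can be matched only to one of its unmatched neighbours. -/
structure Algorithm where
  /-- the distribution of the decision for the data item that has just arrived -/
  decision : ∀ {n m : ℕ}, History n m → DataItem n m → PMF (Option (Fin m))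
  legal : ∀ {n m : ℕ} (h : History n m) (d : DataItem n m) (v : Fin m),
    some v ∈ (decision h d).support → v ∈ available h d.2

/-- The distribution of the final history when the algorithm, having reached the history `h`,
processes the given list of data items one after the other. -/
noncomputable def Algorithm.run (A : Algorithm) {n m : ℕ} :
    List (DataItem n m) → History n m → PMF (History n m)
  | [], h => PMF.pure h
  | d :: ds, h => (A.decision h d).bind fun o => A.run ds (h ++ [(d, o)])

/-- The data items of `I` in the order dictated by the permutation `σ`. -/
def Instance.arrivals {n : ℕ} (I : Instance n) (σ : Equiv.Perm (Fin n)) :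
    List (DataItem n I.m) :=
  List.ofFn fun t => (σ t, I.nbr (σ t))

/-- The expected size (over the random choices of the algorithm) of the matching that the algorithm
constructs when the data items of `I` arrive in the order `σ`. -/
noncomputable def Algorithm.value (A : Algorithm) {n : ℕ} (I : Instance n)
    (σ : Equiv.Perm (Fin n)) : ℝ≥0∞ :=
  ∑' h : History n I.m, A.run (I.arrivals σ) [] h * (matchedCount h : ℝ≥0∞)

/-- The expected value in the random order model: the arrival order is a uniformly random
permutation of the data items. -/
noncomputable def Algorithm.romValue (A : Algorithm) {n : ℕ} (I : Instance n) : ℝ≥0∞ :=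
  (∑ σ : Equiv.Perm (Fin n), A.value I σ) / (n.factorial : ℝ≥0∞)

/-- The asymptotic approximation ratio in the random order model: the limit inferior, as the size
`n` tends to infinity, of the infimum over all instances of size `n` of the expected value divided
by the optimal value. Instances with optimal value `0` (graphs without edges) have no ratio. -/
noncomputable def Algorithm.romAsymptoticRatio (A : Algorithm) : ℝ≥0∞ :=
  Filter.liminf
    (fun n : ℕ => ⨅ (I : Instance n) (_ : 0 < I.opt), A.romValue I / (I.opt : ℝ≥0∞))
    Filter.atTop

/-- The algorithm Random: match the arriving vertex to one of its unmatched neighbours, chosen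
uniformly at random; leave it unmatched if there is none. -/
noncomputable def random : Algorithm where
  decision h d :=
    if hne : (available h d.2).Nonempty then (PMF.uniformOfFinset (available h d.2) hne).map some
    else PMF.pure none
  legal h d v hv := by
    split_ifs at hv with hne
    · simpa using hv
    · simp at hv

end OnlineMatching

/-!
Half of the online vertices are private, adjacent to a single vertex each of a core of size about
`n / 2`, and half are common, adjacent to the whole core and to one further vertex of their own.
There is a perfect matching, but as long as many core vertices are free a common vertex is very
likely to be matched into the core. The private vertex of that core vertex, which cannot have
arrived yet since it would have taken it, is then lost.

Hence only the number `a` of common vertices still to come and the number `f` of free core vertices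
matter. The function `a + f (f + 3) / (2 (a + 1))` is a supersolution of the recursion for the
expected number of vertices still going to be matched; at `a ≈ f ≈ n / 2` it is `3 n / 4 + O(1)`.
-/

namespace OnlineMatching

open Finset
open scoped BigOperators Nat

section Expectation

variable {α β : Type*}

theorem tsum_pure_mul (a : α) (f : α → ℝ≥0∞) : ∑' b, PMF.pure a b * f b = f a := by
  rw [tsum_eq_single a fun b hb => by simp [hb]]
  simp

theorem tsum_bind_mul (p : PMF α) (q : α → PMF β) (f : β → ℝ≥0∞) :
    ∑' b, (p.bind q) b * f b = ∑' a, p a * ∑' b, q a b * f b := by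
  simp_rw [PMF.bind_apply, ← ENNReal.tsum_mul_right, ← ENNReal.tsum_mul_left, mul_assoc]
  exact ENNReal.tsum_comm

theorem tsum_map_mul (p : PMF α) (g : α → β) (f : β → ℝ≥0∞) :
    ∑' b, (p.map g) b * f b = ∑' a, p a * f (g a) := by
  simp_rw [PMF.map, tsum_bind_mul, Function.comp_apply, tsum_pure_mul]

theorem ofReal_expect {s : Finset α} (hs : s.Nonempty) {f : α → ℝ} (hf : ∀ a ∈ s, 0 ≤ f a) :
    ENNReal.ofReal (𝔼 a ∈ s, f a) = (∑ a ∈ s, ENNReal.ofReal (f a)) / #s := by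
  rw [expect_eq_sum_div_card, ENNReal.ofReal_div_of_pos (by exact_mod_cast hs.card_pos),
    ENNReal.ofReal_sum_of_nonneg hf, ENNReal.ofReal_natCast]

theorem tsum_uniformOfFinset_mul_ofReal {s : Finset α} (hs : s.Nonempty) {f : α → ℝ}
    (hf : ∀ a ∈ s, 0 ≤ f a) :
    ∑' a, PMF.uniformOfFinset s hs a * ENNReal.ofReal (f a) = ENNReal.ofReal (𝔼 a ∈ s, f a) := by
  rw [ofReal_expect hs hf, tsum_eq_sum fun a (ha : a ∉ s) => by simp [ha],
    ENNReal.div_eq_inv_mul, mul_sum]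
  exact sum_congr rfl fun a ha => by simp [PMF.uniformOfFinset_apply, ha]

end Expectation

section Orders

variable {α : Type*}

/-- The arrival orders of a finite set: the lists that enumerate it without repetition. -/
def orders (R : Finset α) : Finset (List α) := ⟨R.val.lists, Multiset.lists_nodup_finset R⟩

theorem mem_orders {R : Finset α} {l : List α} : l ∈ orders R ↔ R.val = l :=
  Multiset.mem_lists_iff _ _

theorem card_orders (R : Finset α) : #(orders R) = (#R)! := by
  have hlists : R.val.lists = R.toList.permutations := by
    rw [← Multiset.lists_coe, coe_toList]
  rw [orders, card_mk, hlists, Multiset.coe_card, List.length_permutations, length_toList]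

theorem orders_empty : orders (∅ : Finset α) = {[]} := by
  ext l
  simp [mem_orders, eq_comm]

theorem cons_mem_orders [DecidableEq α] {R : Finset α} {x : α} {l : List α} :
    x :: l ∈ orders R ↔ x ∈ R ∧ l ∈ orders (R.erase x) := by
  simp only [mem_orders, erase_val, ← Multiset.cons_coe]
  constructor
  · intro h
    have hx : x ∈ R := by simp [← mem_val, h]
    exact ⟨hx, by rw [h, Multiset.erase_cons_head]⟩
  · rintro ⟨hx, h⟩
    rw [← h, Multiset.cons_erase hx]

theorem expect_orders_eq_expect_cons [DecidableEq α] {R : Finset α} (hR : R.Nonempty)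
    (G : List α → ℝ) :
    𝔼 l ∈ orders R, G l = 𝔼 x ∈ R, 𝔼 l ∈ orders (R.erase x), G (x :: l) := by
  have hsum : ∑ x ∈ R, ∑ l ∈ orders (R.erase x), G (x :: l) = ∑ l ∈ orders R, G l := by
    rw [sum_sigma']
    refine sum_bij (fun p _ => p.1 :: p.2) (fun p hp => cons_mem_orders.2 (mem_sigma.1 hp)) ?_ ?_
      fun _ _ => rfl
    · rintro ⟨x, l⟩ - ⟨y, l'⟩ - h
      obtain ⟨rfl, rfl⟩ := List.cons.inj h
      rfl
    · rintro (_ | ⟨x, l⟩) hl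
      · simp [mem_orders, hR.ne_empty] at hl
      · exact ⟨⟨x, l⟩, mem_sigma.2 (cons_mem_orders.1 hl), rfl⟩
  have hcard : ((#R)! : ℝ) = (#R - 1)! * #R := by
    rw [mul_comm]
    exact_mod_cast (Nat.mul_factorial_pred hR.card_ne_zero).symm
  rw [expect_eq_sum_div_card, expect_eq_sum_div_card, card_orders, ← hsum, hcard, ← div_div,
    sum_div]
  congr 1
  refine sum_congr rfl fun x hx => ?_
  rw [expect_eq_sum_div_card, card_orders, card_erase_of_mem hx]

theorem expect_perm_eq_expect_orders {n : ℕ} (G : List (Fin n) → ℝ) :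
    𝔼 σ : Equiv.Perm (Fin n), G (List.ofFn σ) = 𝔼 l ∈ orders (univ : Finset (Fin n)), G l := by
  have hinj : Function.Injective fun σ : Equiv.Perm (Fin n) => List.ofFn σ :=
    List.ofFn_injective.comp DFunLike.coe_injective
  have himage : univ.image (fun σ : Equiv.Perm (Fin n) => List.ofFn σ) = orders univ := by
    refine eq_of_subset_of_card_le (image_subset_iff.2 fun σ _ => ?_) ?_
    · rw [mem_orders, ← Fin.univ_val_map, Multiset.map_univ_val_equiv]
    · rw [card_orders, card_image_of_injective _ hinj, card_univ, card_univ, Fintype.card_perm]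
  rw [← himage, expect_image hinj.injOn]

end Orders

section Gain

variable {V : Type*} [DecidableEq V]

/-- The expected number of online vertices that Random matches when vertices with the given
neighbourhoods arrive one after the other and `F` is the set of offline vertices still free. Only
`F` matters here, not the history that led to it. -/
noncomputable def expectedGain : List (Finset V) → Finset V → ℝ
  | [], _ => 0
  | N :: Ns, F =>
      if (N ∩ F).Nonempty then 1 + 𝔼 v ∈ N ∩ F, expectedGain Ns (F.erase v)
      else expectedGain Ns F

theorem expectedGain_nonneg (Ns : List (Finset V)) (F : Finset V) : 0 ≤ expectedGain Ns F := by
  induction Ns generalizing F with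
  | nil => rfl
  | cons N Ns ih =>
    rw [expectedGain]
    split_ifs
    · exact add_nonneg zero_le_one (expect_nonneg fun v _ => ih _)
    · exact ih F

theorem available_eq_inter {n m : ℕ} (h : History n m) (N : Finset (Fin m)) :
    available h N = N ∩ available h univ := by
  ext v
  simp [available]

theorem available_append_some {n m : ℕ} (h : History n m) (d : DataItem n m) (v : Fin m)
    (N : Finset (Fin m)) : available (h ++ [(d, some v)]) N = (available h N).erase v := by
  ext w
  simp only [available, mem_filter, mem_erase, List.forall_mem_append, List.forall_mem_singleton,
    ne_eq, Option.some.injEq]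
  tauto

theorem available_append_none {n m : ℕ} (h : History n m) (d : DataItem n m)
    (N : Finset (Fin m)) : available (h ++ [(d, none)]) N = available h N := by
  simp only [available, List.forall_mem_append, List.forall_mem_singleton, ne_eq, reduceCtorEq,
    not_false_eq_true, and_true]

theorem tsum_run_random_mul_matchedCount {n m : ℕ} (l : List (DataItem n m)) (h : History n m) :
    ∑' h', random.run l h h' * (matchedCount h' : ℝ≥0∞) =
      ENNReal.ofReal (matchedCount h + expectedGain (l.map Prod.snd) (available h univ)) := by
  induction l generalizing h with
  | nil => simp [Algorithm.run, expectedGain]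
  | cons d ds ih =>
    rw [Algorithm.run, tsum_bind_mul, List.map_cons, expectedGain, ← available_eq_inter]
    simp_rw [ih]
    by_cases hne : (available h d.2).Nonempty
    · have hdecision : random.decision h d =
          (PMF.uniformOfFinset (available h d.2) hne).map some := by simp [random, hne]
      rw [hdecision, if_pos hne, tsum_map_mul, tsum_uniformOfFinset_mul_ofReal hne fun v _ =>
        add_nonneg (Nat.cast_nonneg _) (expectedGain_nonneg _ _)]
      simp only [available_append_some, expect_add_distrib, matchedCount, List.countP_append,
        expect_const hne, List.countP_singleton, Option.isSome_some, if_true, Nat.cast_add,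
        Nat.cast_one, add_assoc]
    · have hdecision : random.decision h d = PMF.pure none := by simp [random, hne]
      rw [hdecision, if_neg hne, tsum_pure_mul, available_append_none]
      simp [matchedCount]

/-- The average of `expectedGain` over all arrival orders of a set `R` of online vertices with
neighbourhoods `N`. -/
noncomputable def averageGain {U : Type*} (N : U → Finset V) (R : Finset U) (F : Finset V) : ℝ :=
  𝔼 l ∈ orders R, expectedGain (l.map N) F

theorem romValue_random_eq_averageGain {n : ℕ} (I : Instance n) :
    random.romValue I = ENNReal.ofReal (averageGain I.nbr univ univ) := by
  have harrivals (σ : Equiv.Perm (Fin n)) :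
      (I.arrivals σ).map Prod.snd = (List.ofFn σ).map I.nbr := by
    simp [Instance.arrivals, List.map_ofFn, Function.comp_def]
  have hvalue (σ : Equiv.Perm (Fin n)) :
      random.value I σ = ENNReal.ofReal (expectedGain ((List.ofFn σ).map I.nbr) univ) := by
    rw [Algorithm.value, tsum_run_random_mul_matchedCount, harrivals]
    simp [matchedCount, available]
  rw [averageGain, ← expect_perm_eq_expect_orders fun l => expectedGain (l.map I.nbr) univ,
    ofReal_expect univ_nonempty fun _ _ => expectedGain_nonneg _ _, card_univ, Fintype.card_perm,
    Fintype.card_fin, Algorithm.romValue]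
  simp_rw [hvalue]

variable {U : Type*} {N : U → Finset V} {R : Finset U} {F : Finset V} {x : U}

theorem averageGain_empty : averageGain N ∅ F = 0 := by
  simp [averageGain, orders_empty, expectedGain]

variable [DecidableEq U]

/-- The value of `averageGain` conditional on `x` being the first vertex of `R` to arrive. -/
noncomputable def averageGainFrom (N : U → Finset V) (R : Finset U) (F : Finset V) (x : U) : ℝ :=
  if (N x ∩ F).Nonempty then 1 + 𝔼 v ∈ N x ∩ F, averageGain N (R.erase x) (F.erase v)
  else averageGain N (R.erase x) F

theorem averageGain_eq_expect (hR : R.Nonempty) :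
    averageGain N R F = 𝔼 x ∈ R, averageGainFrom N R F x := by
  rw [averageGain, expect_orders_eq_expect_cons hR]
  refine expect_congr rfl fun x _ => ?_
  have horders : (orders (R.erase x)).Nonempty := by
    rw [← card_pos, card_orders]
    exact Nat.factorial_pos _
  simp only [List.map_cons, expectedGain, averageGainFrom, averageGain]
  split_ifs
  · rw [expect_add_distrib, expect_const horders, expect_comm]
  · rfl

end Gain

section CoreGraph

variable {V : Type*} [DecidableEq V] {C R F : Finset V} {x : V}

/-- The neighbourhoods in the hard instances, whose online and offline vertices are both indexed by
`V`: the online vertex `i` is adjacent to the offline vertex `i`, and the online vertices outside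
of the core `C` are moreover adjacent to all offline vertices in `C`. -/
def coreNbr (C : Finset V) (i : V) : Finset V := if i ∈ C then {i} else insert i C

theorem mem_coreNbr_self : x ∈ coreNbr C x := by
  unfold coreNbr
  split_ifs <;> simp

theorem averageGainFrom_coreNbr_of_mem_of_mem (hxC : x ∈ C) (hxF : x ∈ F) :
    averageGainFrom (coreNbr C) R F x = 1 + averageGain (coreNbr C) (R.erase x) (F.erase x) := by
  have hinter : coreNbr C x ∩ F = {x} := by rw [coreNbr, if_pos hxC, singleton_inter_of_mem hxF]
  rw [averageGainFrom, hinter, if_pos (singleton_nonempty x), expect_singleton]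

theorem averageGainFrom_coreNbr_of_mem_of_notMem (hxC : x ∈ C) (hxF : x ∉ F) :
    averageGainFrom (coreNbr C) R F x = averageGain (coreNbr C) (R.erase x) F := by
  have hinter : coreNbr C x ∩ F = ∅ := by rw [coreNbr, if_pos hxC, singleton_inter_of_notMem hxF]
  rw [averageGainFrom, if_neg (not_nonempty_iff_eq_empty.2 hinter)]

theorem averageGainFrom_coreNbr_le_of_notMem (hxC : x ∉ C) (hxF : x ∈ F) {b c : ℝ}
    (hown : averageGain (coreNbr C) (R.erase x) (F.erase x) ≤ b)
    (hcore : ∀ v ∈ F ∩ C, averageGain (coreNbr C) (R.erase x) (F.erase v) ≤ c) :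
    averageGainFrom (coreNbr C) R F x ≤ 1 + (b + #(F ∩ C) * c) / (#(F ∩ C) + 1) := by
  have hinter : coreNbr C x ∩ F = insert x (F ∩ C) := by
    rw [coreNbr, if_neg hxC, insert_inter_of_mem hxF, inter_comm]
  have hx : x ∉ F ∩ C := fun h => hxC (mem_inter.1 h).2
  have hsum := sum_le_card_nsmul _ _ _ hcore
  rw [nsmul_eq_mul] at hsum
  rw [averageGainFrom, hinter, if_pos (insert_nonempty x _), expect_eq_sum_div_card,
    sum_insert hx, card_insert_of_notMem hx, Nat.cast_add, Nat.cast_one]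
  gcongr

/-- An upper bound for the average gain on the hard instances when `a` online vertices outside of
the core are still to arrive and `f` core vertices are free: the first summand counts the former,
which are always matched, the second one bounds the number of core online vertices still going to
be matched. -/
noncomputable def gainBound (a f : ℝ) : ℝ := a + f * (f + 3) / (2 * (a + 1))

-- `f (f + 3) - (f - 1) (f + 2) = 2 (f + 1)`: the constant `3` in `gainBound` is what makes the
-- denominator `f + 1` cancel.
theorem gainBound_average {a f : ℝ} (ha : a ≠ 0) (hf : f + 1 ≠ 0) :
    (gainBound (a - 1) f + f * gainBound (a - 1) (f - 1)) / (f + 1) =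
      a - 1 + f * (f + 1) / (2 * a) := by
  unfold gainBound
  rw [sub_add_cancel]
  field_simp
  ring

theorem gainBound_step (a f : ℕ) :
    a * (1 + (gainBound (a - 1) f + f * gainBound (a - 1) (f - 1)) / (f + 1)) +
      f * (1 + gainBound a (f - 1)) ≤ (a + f) * gainBound a f := by
  have hcommon : a * (1 + (gainBound (a - 1) f + f * gainBound (a - 1) (f - 1)) / (f + 1)) ≤
      (a : ℝ) * a + f * (f + 1) / 2 := by
    rcases a.eq_zero_or_pos with rfl | ha
    · rw [Nat.cast_zero, zero_mul, zero_mul]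
      positivity
    · have ha' : (a : ℝ) ≠ 0 := by positivity
      rw [gainBound_average ha' (by positivity)]
      exact le_of_eq (by field_simp; ring)
  have hff : (0 : ℝ) ≤ f * (f - 1) := by
    rcases f.eq_zero_or_pos with rfl | hf
    · simp
    · exact mul_nonneg f.cast_nonneg (sub_nonneg.2 (by exact_mod_cast hf))
  have hgap : (a + f) * gainBound a f - (a * a + f * (f + 1) / 2 + f * (1 + gainBound a (f - 1))) =
      f * (f - 1) / (2 * (a + 1)) := by
    unfold gainBound
    field_simp
    ring
  have : (0 : ℝ) ≤ f * (f - 1) / (2 * (a + 1)) := by positivity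
  linarith

theorem sum_eq_sum_sdiff_add_sum_inter_add_sum_sdiff {M : Type*} [AddCommMonoid M]
    (hFR : F ∩ C ⊆ R) (g : V → M) :
    ∑ x ∈ R, g x = ∑ x ∈ R \ C, g x + (∑ x ∈ F ∩ C, g x + ∑ x ∈ (R ∩ C) \ F, g x) := by
  have hFC : R ∩ C ∩ F = F ∩ C := by
    rw [inter_assoc, inter_comm C F, inter_eq_right.2 hFR]
  rw [← sum_inter_add_sum_sdiff R C, ← sum_inter_add_sum_sdiff (R ∩ C) F, hFC, add_comm]

theorem averageGain_le_gainBound_of_averageGainFrom_le {N : V → Finset V} (hR : R.Nonempty)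
    (hFR : F ∩ C ⊆ R) {a f : ℕ} (ha : #(R \ C) = a) (hf : #(F ∩ C) = f)
    (hcommon : ∀ x ∈ R \ C, averageGainFrom N R F x ≤
      1 + (gainBound (a - 1) f + f * gainBound (a - 1) (f - 1)) / (f + 1))
    (hfree : ∀ x ∈ F ∩ C, averageGainFrom N R F x ≤ 1 + gainBound a (f - 1))
    (htaken : ∀ x ∈ (R ∩ C) \ F, averageGainFrom N R F x ≤ gainBound a f) :
    averageGain N R F ≤ gainBound a f := by
  have hcard : (#R : ℝ) = a + (f + #((R ∩ C) \ F)) := by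
    simpa [ha, hf] using sum_eq_sum_sdiff_add_sum_inter_add_sum_sdiff hFR fun _ => (1 : ℝ)
  have hsum_common := sum_le_card_nsmul _ _ _ hcommon
  have hsum_free := sum_le_card_nsmul _ _ _ hfree
  have hsum_taken := sum_le_card_nsmul _ _ _ htaken
  rw [nsmul_eq_mul] at hsum_common hsum_free hsum_taken
  rw [ha] at hsum_common
  rw [hf] at hsum_free
  rw [averageGain_eq_expect hR, expect_eq_sum_div_card, div_le_iff₀ (by exact_mod_cast hR.card_pos),
    sum_eq_sum_sdiff_add_sum_inter_add_sum_sdiff hFR, hcard]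
  linarith [gainBound_step a f]

theorem averageGain_coreNbr_le (hRF : R \ C ⊆ F) (hFR : F ∩ C ⊆ R) :
    averageGain (coreNbr C) R F ≤ gainBound #(R \ C) #(F ∩ C) := by
  induction R using Finset.strongInduction generalizing F with
  | H R ih =>
    rcases R.eq_empty_or_nonempty with rfl | hR
    · rw [averageGain_empty, gainBound]
      positivity
    refine averageGain_le_gainBound_of_averageGainFrom_le hR hFR rfl rfl (fun x hx => ?common)
      (fun x hx => ?free) fun x hx => ?taken
    case common =>
      obtain ⟨hxR, hxC⟩ := mem_sdiff.1 hx
      have hR' : (#(R.erase x \ C) : ℝ) = #(R \ C) - 1 := by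
        rw [erase_sdiff_comm, cast_card_erase_of_mem hx]
      refine averageGainFrom_coreNbr_le_of_notMem hxC (hRF hx) ?_ fun v hv => ?_
      · have hF' : F.erase x ∩ C = F ∩ C := by grind
        rw [← hR', ← hF']
        exact ih _ (erase_ssubset hxR) (by grind) (by grind)
      · rw [← hR', ← cast_card_erase_of_mem hv, ← erase_inter]
        exact ih _ (erase_ssubset hxR) (by grind) (by grind)
    case free =>
      have hR' : R.erase x \ C = R \ C := by grind
      rw [averageGainFrom_coreNbr_of_mem_of_mem (mem_inter.1 hx).2 (mem_inter.1 hx).1, ← hR',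
        ← cast_card_erase_of_mem hx, ← erase_inter]
      gcongr
      exact ih _ (erase_ssubset (hFR hx)) (by grind) (by grind)
    case taken =>
      obtain ⟨⟨hxR, hxC⟩, hxF⟩ : (x ∈ R ∧ x ∈ C) ∧ x ∉ F := by
        rwa [← mem_inter, ← mem_sdiff]
      have hR' : R.erase x \ C = R \ C := by grind
      rw [averageGainFrom_coreNbr_of_mem_of_notMem hxC hxF, ← hR']
      exact ih _ (erase_ssubset hxR) (by grind) (by grind)

end CoreGraph

section AsymptoticRatio

open Filter Topology

theorem Instance.le_opt_of_injective {n : ℕ} (I : Instance n) {f : Fin n → Fin I.m}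
    (hf : f.Injective) (hnbr : ∀ i, f i ∈ I.nbr i) : n ≤ I.opt := by
  classical
  have hgraph : Function.Injective fun i => (i, f i) := fun i j h => (Prod.mk.inj h).1
  have hmatching : I.IsMatching (univ.image fun i => (i, f i)) := by
    simp only [IsMatching, forall_mem_image, mem_univ, true_imp_iff]
    exact ⟨hnbr, fun i j hij => ⟨fun h => hij (by rw [h]), fun h => hij (by rw [hf h])⟩⟩
  calc n = #(univ.image fun i => (i, f i)) := by rw [card_image_of_injective _ hgraph, card_fin]
    _ ≤ I.opt := le_sup (f := card) (mem_filter.2 ⟨mem_univ _, hmatching⟩)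

/-- The hard instance with core `C`. -/
def coreInstance {n : ℕ} (C : Finset (Fin n)) : Instance n := ⟨n, coreNbr C⟩

theorem le_opt_coreInstance {n : ℕ} (C : Finset (Fin n)) : n ≤ (coreInstance C).opt :=
  (coreInstance C).le_opt_of_injective (f := id) Function.injective_id fun _ => mem_coreNbr_self

theorem gainBound_le {a f : ℝ} (hf : 0 ≤ f) (hfa : f ≤ a) (haf : a ≤ f + 1) :
    gainBound a f ≤ 3 / 4 * (a + f) + 2 := by
  have hcore : f * (f + 3) / (2 * (a + 1)) ≤ (f + 2) / 2 := by
    rw [div_le_div_iff₀ (by linarith) two_pos]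
    nlinarith
  unfold gainBound
  linarith

theorem exists_romValue_random_le (n : ℕ) :
    ∃ I : Instance n, n ≤ I.opt ∧ random.romValue I ≤ ENNReal.ofReal (3 / 4 * n + 2) := by
  obtain ⟨C, -, hC⟩ := exists_subset_card_eq (s := (univ : Finset (Fin n))) (n := n / 2)
    (by rw [card_fin]; exact n.div_le_self 2)
  refine ⟨coreInstance C, le_opt_coreInstance C, ?_⟩
  have hcompl : #(univ \ C) = n - n / 2 := by rw [card_univ_sdiff, Fintype.card_fin, hC]
  have hsum : ((n - n / 2 : ℕ) : ℝ) + (n / 2 : ℕ) = n := by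
    exact_mod_cast (by omega : n - n / 2 + n / 2 = n)
  rw [romValue_random_eq_averageGain]
  refine ENNReal.ofReal_le_ofReal ?_
  calc averageGain (coreNbr C) univ univ ≤ gainBound #(univ \ C) #(univ ∩ C) :=
        averageGain_coreNbr_le (subset_univ _) (subset_univ _)
    _ = gainBound (n - n / 2 : ℕ) (n / 2 : ℕ) := by rw [hcompl, univ_inter, hC]
    _ ≤ 3 / 4 * ((n - n / 2 : ℕ) + (n / 2 : ℕ)) + 2 := gainBound_le (Nat.cast_nonneg _)
        (by exact_mod_cast (by omega : n / 2 ≤ n - n / 2))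
        (by exact_mod_cast (by omega : n - n / 2 ≤ n / 2 + 1))
    _ = 3 / 4 * n + 2 := by rw [hsum]

theorem iInf_romValue_random_div_opt_le {n : ℕ} (hn : 0 < n) :
    ⨅ (I : Instance n) (_ : 0 < I.opt), random.romValue I / (I.opt : ℝ≥0∞) ≤
      ENNReal.ofReal (3 / 4 + 2 / n) := by
  obtain ⟨I, hopt, hvalue⟩ := exists_romValue_random_le n
  have hn' : (0 : ℝ) < n := by exact_mod_cast hn
  refine iInf₂_le_of_le I (hn.trans_le hopt) ?_
  calc random.romValue I / (I.opt : ℝ≥0∞) ≤ ENNReal.ofReal (3 / 4 * n + 2) / (n : ℝ≥0∞) :=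
        ENNReal.div_le_div hvalue (by exact_mod_cast hopt)
    _ = ENNReal.ofReal ((3 / 4 * n + 2) / n) := by
        rw [ENNReal.ofReal_div_of_pos hn', ENNReal.ofReal_natCast]
    _ = ENNReal.ofReal (3 / 4 + 2 / n) := by rw [add_div, mul_div_cancel_right₀ _ hn'.ne']

theorem tendsto_ofReal_add_div_natCast (x c : ℝ) :
    Tendsto (fun n : ℕ => ENNReal.ofReal (x + c / n)) atTop (𝓝 (ENNReal.ofReal x)) := by
  simpa using ENNReal.tendsto_ofReal
    (tendsto_const_nhds.add (tendsto_const_div_atTop_nhds_zero_nat c))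

end AsymptoticRatio

end OnlineMatching

theorem mainTheorem10 : OnlineMatching.random.romAsymptoticRatio ≤ 3 / 4 := by
  calc OnlineMatching.random.romAsymptoticRatio
      ≤ Filter.liminf (fun n : ℕ => ENNReal.ofReal (3 / 4 + 2 / n)) Filter.atTop :=
        Filter.liminf_le_liminf <| (Filter.eventually_gt_atTop 0).mono fun _ =>
          OnlineMatching.iInf_romValue_random_div_opt_le
    _ = ENNReal.ofReal (3 / 4) := (OnlineMatching.tendsto_ofReal_add_div_natCast _ _).liminf_eq
    _ = 3 / 4 := by rw [ENNReal.ofReal_div_of_pos (by norm_num)]; norm_num
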